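/- For complex parameters with a vertical line $\operatorname{Re}s=c$ separating the poles of $\prod_{j\le m}\Gamma(b_j-s)$ (to its right) from those of $\prod_{j\le n}\Gamma(1-a_j+s)$ (to its left), let $$G^{m,n}_{p,q}\Big(z\,\Big|\begin{array}{c}a_1,\dots,a_p\\ b_1,\dots,b_q\end{array}\Big)=\frac1{2\pi i}\int_{c-i\infty}^{c+i\infty}\frac{\prod_{j=1}^m\Gamma(b_j-s)\prod_{j=1}^n\Gamma(1-a_j+s)}{\prod_{j=m+1}^q\Gamma(1-b_j+s)\prod_{j=n+1}^p\Gamma(a_j-s)}\,z^s\,ds$$ be the Meijer $G$-function. (1) Let $k,w>0$ and let the SNR $\gamma$ be a random variable that is Gamma distributed with shape $k$ and scale $w$. Then $\log_2(1+\gamma)$ is integrable, the integral that defines the $G$-function below converges absolutely over every separating vertical line (such lines exist) with a value independent of the line, and the ergodic rate $\bar R=\mathbb E[\log_2(1+\gamma)]$ is $$\bar R=\frac{1}{\Gamma(k)\ln 2}\;G^{3,1}_{2,3}\Big(\frac1w\,\Big|\begin{array}{c}0,1\\ 0,0,k\end{array}\Big).\qquad(*)$$ (2) Consider a link assisted by a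 reconfigurable surface with $M\ge1$ elements in rows of $M_H\ge1$ with spacing $d_r>0$, wavelength $\lambda>0$, large-scale fading coefficients $\beta_{sd},\beta_{sr},\beta_{rd}>0$, Rician factors $K_{sr},K_{rd}\ge0$, and transmit power to noise power ratio $\nu=\rho/\sigma^2$ with $\rho,\sigma^2>0$. For $\alpha\in\{sr,rd\}$ with angles $\psi_\alpha,\phi_\alpha\in\mathbb R$ let $\mathbf a_\alpha=(e^{i\mathbf k_\alpha^T\mathbf u_m})_{m=1}^M$, where $\mathbf k_\alpha=\frac{2\pi}\lambda(\cos\psi_\alpha\cos\phi_\alpha,\ \sin\psi_\alpha\cos\phi_\alpha,\ \sin\psi_\alpha)^T$ and $\mathbf u_m=(0,\ ((m-1)\bmod M_H)d_r,\ \lfloor (m-1)/M_H\rfloor d_r)^T$. Put $\omega=(K_{sr}+1)(K_{rd}+1)$ and $\widetilde K=K_{sr}+K_{rd}+1$. Let $\theta\in\mathbb R^M$ be arbitrary phase shifts that do not depend on the small-scale fading (for example the long-term optimal ones), $\Phi=\mathrm{diag}(e^{i\theta_1},\dots,e^{i\theta_M})$, $\eta=|\mathbf a_{sr}^H\Phi\,\mathbf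 a_{rd}|^2$, $$o_1=\omega^{-1}(K_{sr}K_{rd}\eta+\widetilde KM),\qquad o_2=\omega^{-2}\big(2\eta K_{sr}K_{rd}(M\widetilde K+4)+M^2\widetilde K^2+2M(2\widetilde K-1)\big),$$ $$k=\frac{(\beta_{sd}+o_1\beta_{sr}\beta_{rd})^2}{\beta_{sd}^2+o_2\beta_{sr}^2\beta_{rd}^2+2\beta_{sd}o_1\beta_{sr}\beta_{rd}},\qquad w=\nu\,\frac{\beta_{sd}^2+o_2\beta_{sr}^2\beta_{rd}^2+2\beta_{sd}o_1\beta_{sr}\beta_{rd}}{\beta_{sd}+o_1\beta_{sr}\beta_{rd}}.$$ Then $k,w>0$, and $(*)$ holds if $\gamma$ is taken to be Gamma distributed with this shape $k$ and scale $w$. (3) For the same link and the short-term optimal phase shifts, let $$k=\frac{k_c(k_c+1)}{2(2k_c+3)},\quad w=2\nu w_c^2(2k_c+3),\quad k_c=\frac{(c_1+c_2\sqrt{\beta_{sr}\beta_{rd}})^2}{c_3+c_4\beta_{sr}\beta_{rd}},\quad w_c=\frac{c_3+c_4\beta_{sr}\beta_{rd}}{c_1+c_2\sqrt{\beta_{sr}\beta_{rd}}},$$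 with $c_1=\frac12\sqrt{\pi\beta_{sd}}$, $c_2=\frac14M\pi\,t_{sr}t_{rd}\,\omega^{-1/2}$, $c_3=\frac{4-\pi}4\beta_{sd}$, $c_4=M-\frac{M\pi^2}{16}t_{sr}^2t_{rd}^2\omega^{-1}$ and $t_\alpha={}_1F_1(-\tfrac12,1,-K_\alpha)$. Then $k,w>0$, and $(*)$ holds if $\gamma$ is taken to be Gamma distributed with this shape $k$ and scale $w$. -/

import Mathlib

open MeasureTheory ProbabilityTheory

noncomputable section

/-! ### The Meijer G-function -/

/-- The Mellin-Barnes integrand of `G^{m,n}_{p,q}(z | a; b)`: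
`∏_{j ≤ m} Γ(b_j - s) ∏_{j ≤ n} Γ(1 - a_j + s)`
divided by `∏_{m < j ≤ q} Γ(1 - b_j + s) ∏_{n < j ≤ p} Γ(a_j - s)`, times `z ^ s`
(principal branch).  At a pole of `Γ` Mathlib has `Γ = 0`, so that the factors `(Γ ·)⁻¹` are the
values of the entire function `1 / Γ`. -/
def meijerGIntegrand (m n : ℕ) {p q : ℕ} (a : Fin p → ℂ) (b : Fin q → ℂ) (z s : ℂ) : ℂ :=
  (∏ j : Fin q, if (j : ℕ) < m then Complex.Gamma (b j - s)
      else (Complex.Gamma (1 - b j + s))⁻¹) *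
    (∏ j : Fin p, if (j : ℕ) < n then Complex.Gamma (1 - a j + s)
      else (Complex.Gamma (a j - s))⁻¹) * z ^ s

/-- The vertical line `Re s = c` separates the poles `b_j + l` (`j ≤ m`, `l = 0, 1, 2, …`) of the
factors `Γ(b_j - s)`, which lie to its right, from the poles `a_j - 1 - l` (`j ≤ n`) of the factors
`Γ(1 - a_j + s)`, which lie to its left. -/
def MeijerGSeparates (m n : ℕ) {p q : ℕ} (a : Fin p → ℂ) (b : Fin q → ℂ) (c : ℝ) : Prop :=
  (∀ j : Fin q, (j : ℕ) < m → ∀ l : ℕ, c < (b j + l).re) ∧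
    (∀ j : Fin p, (j : ℕ) < n → ∀ l : ℕ, (a j - 1 - l).re < c)

/-- `(2πi)⁻¹ ∫ F(s) ds` along `Re s = c`, upwards, with `F` the Mellin-Barnes integrand
(`s = c + it`, `ds = i dt`). -/
def meijerGLine (m n : ℕ) {p q : ℕ} (a : Fin p → ℂ) (b : Fin q → ℂ) (z : ℂ) (c : ℝ) : ℂ :=
  (2 * Real.pi * Complex.I)⁻¹ *
    ∫ t : ℝ, meijerGIntegrand m n a b z (c + t * Complex.I) * Complex.I

open Classical in
/-- The Meijer G-function `G^{m,n}_{p,q}(z | a_1, …, a_p; b_1, …, b_q)`, by its Mellin-Barnes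
integral over a vertical line that separates the two families of poles (the value `0` is a
convention where there is no such line). -/
def meijerG (m n : ℕ) {p q : ℕ} (a : Fin p → ℂ) (b : Fin q → ℂ) (z : ℂ) : ℂ :=
  if h : ∃ c : ℝ, MeijerGSeparates m n a b c then meijerGLine m n a b z h.choose else 0

/-- The Mellin-Barnes integral that defines `G^{m,n}_{p,q}(z | a; b)` makes sense: there is a
separating vertical line, the integral over each of them converges absolutely, and all of them
give the value `meijerG m n a b z`. -/
def MeijerGWellDefined (m n : ℕ) {p q : ℕ} (a : Fin p → ℂ) (b : Fin q → ℂ) (z : ℂ) : Prop :=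
  (∃ c : ℝ, MeijerGSeparates m n a b c) ∧
    ∀ c : ℝ, MeijerGSeparates m n a b c →
      Integrable (fun t : ℝ => meijerGIntegrand m n a b z (c + t * Complex.I)) ∧
        meijerGLine m n a b z c = meijerG m n a b z

/-! ### The ergodic rate -/

/-- The ergodic rate `E[log₂(1 + γ)]` for the random SNR `γ`. -/
def ergodicRate {Ω : Type*} [MeasurableSpace Ω] (P : Measure Ω) (γ : Ω → ℝ) : ℝ :=
  ∫ x, Real.logb 2 (1 + γ x) ∂P

/-! ### The parameters of the approximating Gamma distributions -/

/-- Kummer's confluent hypergeometric function `₁F₁(a, b, x) = ∑ (a)_n / (b)_n * x ^ n / n!`. -/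
def kummer (a b x : ℝ) : ℝ :=
  ∑' n : ℕ, (ascPochhammer ℝ n).eval a / (ascPochhammer ℝ n).eval b * x ^ n / (n.factorial : ℝ)

/-- The data of the RIS-assisted link: `M` elements in rows of `MH` with spacing `dr`, wavelength
`wl`, angles `psi`, `phi` towards the source (`sr`) and the destination (`rd`), large-scale fading
coefficients `beta`, Rician factors `K`, transmit power `rho` and noise power `sigma2`. -/
structure RISLink where
  M : ℕ
  MH : ℕ
  dr : ℝ
  wl : ℝ
  psiSR : ℝ
  phiSR : ℝ
  psiRD : ℝ
  phiRD : ℝ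
  betaSD : ℝ
  betaSR : ℝ
  betaRD : ℝ
  KSR : ℝ
  KRD : ℝ
  rho : ℝ
  sigma2 : ℝ

namespace RISLink

/-- The standing assumptions on the data. -/
structure Admissible (S : RISLink) : Prop where
  M_pos : 0 < S.M
  MH_pos : 0 < S.MH
  dr_pos : 0 < S.dr
  wl_pos : 0 < S.wl
  betaSD_pos : 0 < S.betaSD
  betaSR_pos : 0 < S.betaSR
  betaRD_pos : 0 < S.betaRD
  KSR_nonneg : 0 ≤ S.KSR
  KRD_nonneg : 0 ≤ S.KRD
  rho_pos : 0 < S.rho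
  sigma2_pos : 0 < S.sigma2

variable (S : RISLink)

/-- The transmit power to noise power ratio `ν = ρ / σ²`. -/
def nu : ℝ := S.rho / S.sigma2

/-- The wave vector `(2π/λ) [cos ψ cos φ, sin ψ cos φ, sin ψ]ᵀ`. -/
def waveVector (psi phi : ℝ) : Fin 3 → ℝ :=
  (2 * Real.pi / S.wl) •
    ![Real.cos psi * Real.cos phi, Real.sin psi * Real.cos phi, Real.sin psi]

/-- The position `[0, mod(m-1, M_H) d_r, ⌊(m-1)/M_H⌋ d_r]ᵀ` of the `m`-th element; the index here
starts at `0`. -/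
def position (m : Fin S.M) : Fin 3 → ℝ :=
  ![0, ((m : ℕ) % S.MH : ℕ) * S.dr, ((m : ℕ) / S.MH : ℕ) * S.dr]

/-- The array response `[e^{j kᵀu_1}, …, e^{j kᵀu_M}]ᵀ`, so that the line-of-sight channel is
`√(K β / (K + 1))` times it. -/
def response (psi phi : ℝ) : Fin S.M → ℂ := fun m =>
  Complex.exp (Complex.I * ((S.waveVector psi phi ⬝ᵥ S.position m : ℝ) : ℂ))

/-- The phase shift matrix `Φ = diag(e^{jθ_1}, …, e^{jθ_M})`. -/
def phaseMatrix (θ : Fin S.M → ℝ) : Matrix (Fin S.M) (Fin S.M) ℂ :=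
  Matrix.diagonal fun m => Complex.exp (Complex.I * (θ m : ℂ))

/-- `η = |a_srᴴ Φ a_rd|²` for the array responses `a_sr`, `a_rd`. -/
def eta (θ : Fin S.M → ℝ) : ℝ :=
  ‖star (S.response S.psiSR S.phiSR) ⬝ᵥ
    (S.phaseMatrix θ).mulVec (S.response S.psiRD S.phiRD)‖ ^ 2

/-- `ω = (K_sr + 1)(K_rd + 1)`. -/
def om : ℝ := (S.KSR + 1) * (S.KRD + 1)

/-- `K̃ = K_sr + K_rd + 1`. -/
def Kt : ℝ := S.KSR + S.KRD + 1

def o1 (θ : Fin S.M → ℝ) : ℝ := S.om⁻¹ * (S.KSR * S.KRD * S.eta θ + S.Kt * S.M)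

def o2 (θ : Fin S.M → ℝ) : ℝ :=
  (S.om ^ 2)⁻¹ * (2 * S.eta θ * S.KSR * S.KRD * (S.M * S.Kt + 4) +
    (S.M : ℝ) ^ 2 * S.Kt ^ 2 + 2 * S.M * (2 * S.Kt - 1))

/-- Mean of the cascaded-plus-direct channel gain `|h_sd + h_srᴴ Φ h_rd|²`. -/
def gainMean (θ : Fin S.M → ℝ) : ℝ := S.betaSD + S.o1 θ * S.betaSR * S.betaRD

/-- Variance of the same channel gain. -/
def gainVar (θ : Fin S.M → ℝ) : ℝ :=
  S.betaSD ^ 2 + S.o2 θ * S.betaSR ^ 2 * S.betaRD ^ 2 +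
    2 * S.betaSD * S.o1 θ * S.betaSR * S.betaRD

/-- Shape parameter for phase shifts `θ` that do not depend on the small-scale fading. -/
def kLT (θ : Fin S.M → ℝ) : ℝ := S.gainMean θ ^ 2 / S.gainVar θ

/-- Scale parameter for phase shifts `θ` that do not depend on the small-scale fading. -/
def wLT (θ : Fin S.M → ℝ) : ℝ := S.nu * S.gainVar θ / S.gainMean θ

def tSR : ℝ := kummer (-1 / 2) 1 (-S.KSR)

def tRD : ℝ := kummer (-1 / 2) 1 (-S.KRD)

def c1 : ℝ := Real.sqrt (Real.pi * S.betaSD) / 2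

def c2 : ℝ := S.M * Real.pi / 4 * S.tSR * S.tRD / Real.sqrt S.om

def c3 : ℝ := (4 - Real.pi) / 4 * S.betaSD

def c4 : ℝ := S.M - S.M * Real.pi ^ 2 / 16 * S.tSR ^ 2 * S.tRD ^ 2 * S.om⁻¹

def kc : ℝ :=
  (S.c1 + S.c2 * Real.sqrt (S.betaSR * S.betaRD)) ^ 2 / (S.c3 + S.c4 * S.betaSR * S.betaRD)

def wc : ℝ :=
  (S.c3 + S.c4 * S.betaSR * S.betaRD) / (S.c1 + S.c2 * Real.sqrt (S.betaSR * S.betaRD))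

/-- Shape parameter for the short-term phase shift design. -/
def kST : ℝ := S.kc * (S.kc + 1) / (2 * (2 * S.kc + 3))

/-- Scale parameter for the short-term phase shift design. -/
def wST : ℝ := 2 * S.nu * S.wc ^ 2 * (2 * S.kc + 3)

end RISLink

end

/-! The formula is Mellin inversion of `log (1 + x)`, averaged over `x`. For `-1 < Re s < 0` the
Mellin transform of `log (1 + x)` is `π / (s sin πs)` (`mellin_log_one_add_eq_pi_div`), and it is
integrable along each vertical line of that strip, so `log (1 + x)` is an integral of multiples of
`x ^ (-s)` (`log_one_add_eq_integral`). A Gamma variable of rate `r = 1 / w` has `E[x ^ (-s)] = r ^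
s Γ(k - s) / Γ(k)`. After Fubini the integrand is, up to the factor `Γ(k)`, that of the G-function
(`meijerGIntegrand_eq`), and the separating lines are exactly those of the strip. Every line thus
gives `Γ(k) E[log (1 + x)]`, so independence of the line needs no contour shift.

For the link parameters only positivity remains to be shown. It is delicate in one place, `c4 ≥ 0`,
which amounts to "mean ≤ root mean square" for Rician amplitudes (`pi_div_four_mul_sq_kummer_le`).
Kummer's transformation turns the mean into a Poisson average of `Γ(n + 3/2) / n! ≤ √(n + 1)`, and
concavity of the square root bounds this by `√(K + 1)`. -/

/-! ### Bounds on the Kummer function `₁F₁(-1/2, 1, -x)` -/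

lemma ascPochhammer_eval_eq_Gamma_div {a : ℝ} (ha : 0 < a) (n : ℕ) :
    (ascPochhammer ℝ n).eval a = Real.Gamma (a + n) / Real.Gamma a := by
  have h := (Real.Gamma_pos_of_pos ha).ne'
  induction n with
  | zero => simp [h]
  | succ n ih =>
    rw [ascPochhammer_succ_eval, ih, Nat.cast_succ, ← add_assoc,
      Real.Gamma_add_one (by positivity)]
    field_simp

/-- Log-convexity of `Γ` at the midpoint of `x` and `x + 1`. -/
lemma sq_Gamma_add_half_le {x : ℝ} (hx : 0 < x) :
    Real.Gamma (x + 1 / 2) ^ 2 ≤ x * Real.Gamma x ^ 2 := by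
  have hG := Real.Gamma_pos_of_pos hx
  have h := Real.Gamma_mul_add_mul_le_rpow_Gamma_mul_rpow_Gamma hx (by positivity : 0 < x + 1)
    (by norm_num : (0 : ℝ) < 1 / 2) (by norm_num : (0 : ℝ) < 1 / 2) (by norm_num)
  rw [show 1 / 2 * x + 1 / 2 * (x + 1) = x + 1 / 2 by ring, Real.Gamma_add_one hx.ne',
    ← Real.mul_rpow hG.le (by positivity), ← Real.sqrt_eq_rpow,
    show Real.Gamma x * (x * Real.Gamma x) = x * Real.Gamma x ^ 2 by ring] at h
  calc _ ≤ √(x * Real.Gamma x ^ 2) ^ 2 :=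
        pow_le_pow_left₀ (Real.Gamma_pos_of_pos (by positivity)).le h 2
    _ = _ := Real.sq_sqrt (by positivity)

lemma pi_div_four_mul_sq_ascPochhammer_le (n : ℕ) :
    Real.pi / 4 * ((ascPochhammer ℝ n).eval (3 / 2) / n.factorial) ^ 2 ≤ n + 1 := by
  have h := sq_Gamma_add_half_le (x := n + 1) (by positivity)
  rw [Real.Gamma_nat_eq_factorial, show (n : ℝ) + 1 + 1 / 2 = 3 / 2 + n by ring] at h
  have h2 : Real.Gamma (3 / 2) = √Real.pi / 2 := by
    rw [show (3 / 2 : ℝ) = 1 / 2 + 1 by norm_num, Real.Gamma_add_one (by norm_num),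
      Real.Gamma_one_half_eq]
    ring
  rw [ascPochhammer_eval_eq_Gamma_div (by norm_num), h2]
  have hpi := Real.pi_pos
  have e : Real.pi / 4 * (Real.Gamma (3 / 2 + n) / (√Real.pi / 2) / n.factorial) ^ 2 =
      Real.Gamma (3 / 2 + n) ^ 2 / (n.factorial : ℝ) ^ 2 := by
    rw [div_pow, div_pow, div_pow, Real.sq_sqrt hpi.le]
    field_simp
    norm_num
  rw [e, div_le_iff₀ (by positivity)]
  exact h

/-- Chu–Vandermonde for `choose (1/2 + n) n`, split as `1/2` plus `n`. It gives the coefficients of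
the Cauchy product in Kummer's transformation. -/
lemma sum_antidiagonal_ascPochhammer_neg_half (n : ℕ) :
    ∑ ij ∈ Finset.HasAntidiagonal.antidiagonal n,
      (ascPochhammer ℝ ij.1).eval (-1 / 2) * (-1) ^ ij.1 / (ij.1.factorial : ℝ) ^ 2 *
        (ij.2.factorial : ℝ)⁻¹ =
      (ascPochhammer ℝ n).eval (3 / 2) / (n.factorial : ℝ) ^ 2 := by
  have key (r : ℝ) (m : ℕ) :
      (m.factorial : ℝ) * Ring.choose r m = (ascPochhammer ℝ m).eval (r - m + 1) := by
    have h := Ring.descPochhammer_eq_factorial_smul_choose r m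
    rw [Polynomial.descPochhammer_smeval_eq_ascPochhammer,
      Polynomial.ascPochhammer_smeval_eq_eval, nsmul_eq_mul] at h
    exact h.symm
  have key2 (m : ℕ) : (m.factorial : ℝ) * Ring.choose (1 / 2 : ℝ) m =
      (ascPochhammer ℝ m).eval (-1 / 2) * (-1) ^ m := by
    have h := Ring.descPochhammer_eq_factorial_smul_choose (1 / 2 : ℝ) m
    have h3 := Polynomial.ascPochhammer_smeval_neg_eq_descPochhammer (1 / 2 : ℝ) m
    rw [Polynomial.ascPochhammer_smeval_eq_eval, h, nsmul_eq_mul] at h3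
    rw [show (-1 / 2 : ℝ) = -(1 / 2) by norm_num, h3]
    rcases Nat.even_or_odd m with hm | hm
    · rw [Int.negOnePow_even _ (by exact_mod_cast hm), hm.neg_one_pow]
      simp
    · rw [Int.negOnePow_odd _ (by exact_mod_cast hm), hm.neg_one_pow]
      simp
  have hv := Ring.add_choose_eq (r := (1 / 2 : ℝ)) (s := (n : ℝ)) n (Commute.all _ _)
  have hn := key (1 / 2 + n) n
  rw [show (1 / 2 : ℝ) + n - n + 1 = 3 / 2 by ring] at hn
  rw [← hn, hv, eq_div_iff (by positivity), Finset.mul_sum, Finset.sum_mul]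
  refine Finset.sum_congr rfl fun ij hij => ?_
  have hs := Finset.HasAntidiagonal.mem_antidiagonal.mp hij
  rw [← key2, Ring.choose_natCast]
  have hc : (n.choose ij.2 : ℝ) * ij.2.factorial * ij.1.factorial = n.factorial := by
    have := Nat.choose_mul_factorial_mul_factorial (show ij.2 ≤ n by omega)
    rw [show n - ij.2 = ij.1 by omega] at this
    exact_mod_cast this
  rw [← hc]
  have h1 : (ij.1.factorial : ℝ) ≠ 0 := by positivity
  have h2 : (ij.2.factorial : ℝ) ≠ 0 := by positivity
  field_simp

/-- Lets the exponential series dominate the Kummer series. -/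
lemma abs_ascPochhammer_neg_half_le (n : ℕ) :
    |(ascPochhammer ℝ n).eval (-1 / 2)| ≤ n.factorial := by
  induction n with
  | zero => simp
  | succ n ih =>
    rw [ascPochhammer_succ_eval, abs_mul, Nat.factorial_succ, mul_comm (n + 1), Nat.cast_mul]
    have : |-1 / 2 + (n : ℝ)| ≤ (n + 1 : ℕ) := by
      have := n.cast_nonneg (α := ℝ)
      rw [abs_le]
      push_cast
      constructor <;> linarith
    gcongr

/-- Kummer's transformation `e^x ₁F₁(-1/2, 1, -x) = ₁F₁(3/2, 1, x)`. -/
lemma hasSum_kummer_mul_exp {x : ℝ} (hx : 0 ≤ x) :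
    HasSum (fun n : ℕ => (ascPochhammer ℝ n).eval (3 / 2) / n.factorial * (x ^ n / n.factorial))
      (kummer (-1 / 2) 1 (-x) * Real.exp x) := by
  have hf : Summable fun n : ℕ => ‖(ascPochhammer ℝ n).eval (-1 / 2) /
      (ascPochhammer ℝ n).eval 1 * (-x) ^ n / (n.factorial : ℝ)‖ := by
    refine Summable.of_nonneg_of_le (fun _ => norm_nonneg _) (fun n => ?_)
      (Real.summable_pow_div_factorial x)
    rw [ascPochhammer_eval_one, norm_div, norm_mul, norm_div, norm_pow, norm_neg,
      Real.norm_natCast, Real.norm_eq_abs, Real.norm_of_nonneg hx]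
    have := div_le_one_of_le₀ (abs_ascPochhammer_neg_half_le n) (Nat.cast_nonneg _)
    gcongr
    exact mul_le_of_le_one_left (by positivity) this
  have hg : Summable fun n : ℕ => ‖x ^ n / (n.factorial : ℝ)‖ :=
    NormedSpace.norm_expSeries_div_summable x
  have hexp : Real.exp x = ∑' n : ℕ, x ^ n / (n.factorial : ℝ) := by
    rw [Real.exp_eq_exp_ℝ, NormedSpace.exp_eq_tsum_div]
  have hsum := (summable_norm_sum_mul_antidiagonal_of_summable_norm hf hg).of_norm.hasSum
  rw [← tsum_mul_tsum_eq_tsum_sum_antidiagonal_of_summable_norm hf hg, ← hexp] at hsum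
  convert! hsum using 2 with n
  rw [div_mul_div_comm, ← sq, mul_div_right_comm, ← sum_antidiagonal_ascPochhammer_neg_half,
    Finset.sum_mul]
  refine Finset.sum_congr rfl fun ij hij => ?_
  rw [← Finset.HasAntidiagonal.mem_antidiagonal.mp hij, ascPochhammer_eval_one, neg_pow x, pow_add]
  field_simp

/-- For `x ≥ 0`, up to the factor `e^x`, this is the mean of `N + 1` for a Poisson variable `N` of
parameter `x`. -/
lemma hasSum_succ_mul_pow_div_factorial (x : ℝ) :
    HasSum (fun n : ℕ => ((n : ℝ) + 1) * (x ^ n / n.factorial)) ((x + 1) * Real.exp x) := by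
  have h : HasSum (fun n : ℕ => x ^ n / (n.factorial : ℝ)) (Real.exp x) := by
    rw [Real.exp_eq_exp_ℝ]
    exact NormedSpace.expSeries_div_hasSum_exp x
  have h2 : HasSum (fun n : ℕ => (n : ℝ) * (x ^ n / n.factorial)) (x * Real.exp x) := by
    rw [← hasSum_nat_add_iff' 1]
    simp only [Finset.range_one, Finset.sum_singleton, CharP.cast_eq_zero, zero_mul, sub_zero]
    convert! h.mul_left x using 2 with n
    rw [Nat.factorial_succ, Nat.cast_mul, pow_succ]
    field_simp
  simpa only [add_mul, one_mul] using h2.add h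

lemma kummer_neg_half_nonneg {x : ℝ} (hx : 0 ≤ x) : 0 ≤ kummer (-1 / 2) 1 (-x) := by
  refine nonneg_of_mul_nonneg_left ((hasSum_kummer_mul_exp hx).nonneg fun n => ?_)
    (Real.exp_pos x)
  have := ascPochhammer_pos n (3 / 2 : ℝ) (by norm_num)
  positivity

/-- The mean of a Rician variable is at most its root mean square. -/
lemma pi_div_four_mul_sq_kummer_le {x : ℝ} (hx : 0 ≤ x) :
    Real.pi / 4 * kummer (-1 / 2) 1 (-x) ^ 2 ≤ x + 1 := by
  -- Jensen's inequality is proved termwise with the tangent of the square root at `a² = x + 1`, the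
  -- Poisson mean of `n + 1`: `√(n + 1) ≤ (n + 1) / (2a) + a / 2`. Averaging the right side gives
  -- exactly `a`.
  set a := √(x + 1) with ha
  have ha0 : 0 < a := Real.sqrt_pos.mpr (by linarith)
  have ha2 : a ^ 2 = x + 1 := Real.sq_sqrt (by linarith)
  have hq : (√Real.pi / 2) ^ 2 = Real.pi / 4 := by
    rw [div_pow, Real.sq_sqrt Real.pi_pos.le]; norm_num
  have h1 := (hasSum_kummer_mul_exp hx).mul_left (√Real.pi / 2)
  have hexp : HasSum (fun n : ℕ => x ^ n / (n.factorial : ℝ)) (Real.exp x) := by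
    rw [Real.exp_eq_exp_ℝ]
    exact NormedSpace.expSeries_div_hasSum_exp x
  have h2 := ((hasSum_succ_mul_pow_div_factorial x).mul_left (1 / (2 * a))).add
    (hexp.mul_left (a / 2))
  have h3 := hasSum_le (fun n => ?_) h1 h2
  · rw [← mul_assoc, ← mul_assoc, ← add_mul, ← ha2] at h3
    have h4 := le_of_mul_le_mul_right h3 (Real.exp_pos x)
    rw [show 1 / (2 * a) * a ^ 2 + a / 2 = a by field_simp; ring] at h4
    rw [← ha2, ← hq, ← mul_pow]
    have := kummer_neg_half_nonneg hx
    exact pow_le_pow_left₀ (by positivity) h4 2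
  · rw [← mul_assoc, ← mul_assoc, ← add_mul]
    refine mul_le_mul_of_nonneg_right ?_ (by positivity)
    have h5 := pi_div_four_mul_sq_ascPochhammer_le n
    rw [← hq, ← mul_pow] at h5
    set y := √Real.pi / 2 * ((ascPochhammer ℝ n).eval (3 / 2) / n.factorial)
    have h6 : 1 / (2 * a) * (n + 1) + a / 2 = (n + 1 + a ^ 2) / (2 * a) := by field_simp
    rw [h6, le_div_iff₀ (by positivity)]
    nlinarith [sq_nonneg (y - a)]

/-! ### Positivity of the shape and scale parameters -/

namespace RISLink

variable {S : RISLink}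

lemma Admissible.om_pos (h : S.Admissible) : 0 < S.om := by
  have := h.KSR_nonneg
  have := h.KRD_nonneg
  unfold om
  positivity

lemma Admissible.nu_pos (h : S.Admissible) : 0 < S.nu := div_pos h.rho_pos h.sigma2_pos

lemma Admissible.gainMean_pos (h : S.Admissible) (θ : Fin S.M → ℝ) : 0 < S.gainMean θ := by
  have := h.KSR_nonneg
  have := h.KRD_nonneg
  have := h.betaSD_pos
  have := h.betaSR_pos
  have := h.betaRD_pos
  have := h.om_pos
  unfold gainMean o1 Kt eta
  positivity

lemma Admissible.gainVar_pos (h : S.Admissible) (θ : Fin S.M → ℝ) : 0 < S.gainVar θ := by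
  have := h.KSR_nonneg
  have := h.KRD_nonneg
  have := h.betaSD_pos
  have := h.betaSR_pos
  have := h.betaRD_pos
  have := h.om_pos
  -- The only subtraction in the variance is harmless because `K̃ ≥ 1`.
  have hK : 0 ≤ 2 * S.Kt - 1 := by unfold Kt; linarith
  have hK' : 0 ≤ S.Kt := by linarith
  unfold gainVar o2 o1 eta
  positivity

lemma Admissible.kLT_pos (h : S.Admissible) (θ : Fin S.M → ℝ) : 0 < S.kLT θ :=
  div_pos (pow_pos (h.gainMean_pos θ) 2) (h.gainVar_pos θ)

lemma Admissible.wLT_pos (h : S.Admissible) (θ : Fin S.M → ℝ) : 0 < S.wLT θ :=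
  div_pos (mul_pos h.nu_pos (h.gainVar_pos θ)) (h.gainMean_pos θ)

/-- Apart from the factor `M`, this is one minus a product of two ratios (squared mean over mean
square), one for each hop. -/
lemma Admissible.c4_nonneg (h : S.Admissible) : 0 ≤ S.c4 := by
  have h1 := pi_div_four_mul_sq_kummer_le h.KSR_nonneg
  have h2 := pi_div_four_mul_sq_kummer_le h.KRD_nonneg
  have h3 : (Real.pi / 4 * S.tSR ^ 2) * (Real.pi / 4 * S.tRD ^ 2) ≤ S.om :=
    mul_le_mul h1 h2 (by positivity) (by linarith [h.KSR_nonneg])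
  have h4 := mul_inv_le_one_of_le₀ h3 h.om_pos.le
  have h5 : S.c4 = S.M *
      (1 - (Real.pi / 4 * S.tSR ^ 2) * (Real.pi / 4 * S.tRD ^ 2) * S.om⁻¹) := by
    unfold c4; ring
  rw [h5]
  exact mul_nonneg (Nat.cast_nonneg _) (by linarith)

lemma Admissible.cascade_mean_pos (h : S.Admissible) :
    0 < S.c1 + S.c2 * √(S.betaSR * S.betaRD) := by
  have h1 : 0 ≤ S.tSR := kummer_neg_half_nonneg h.KSR_nonneg
  have h2 : 0 ≤ S.tRD := kummer_neg_half_nonneg h.KRD_nonneg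
  have := h.betaSD_pos
  unfold c1 c2
  positivity

lemma Admissible.cascade_var_pos (h : S.Admissible) :
    0 < S.c3 + S.c4 * S.betaSR * S.betaRD := by
  have h1 : 0 < S.c3 :=
    mul_pos (div_pos (by linarith [Real.pi_lt_four]) (by norm_num)) h.betaSD_pos
  have := h.c4_nonneg
  have := h.betaSR_pos
  have := h.betaRD_pos
  positivity

lemma Admissible.kc_pos (h : S.Admissible) : 0 < S.kc :=
  div_pos (pow_pos h.cascade_mean_pos 2) h.cascade_var_pos

lemma Admissible.wc_pos (h : S.Admissible) : 0 < S.wc :=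
  div_pos h.cascade_var_pos h.cascade_mean_pos

lemma Admissible.kST_pos (h : S.Admissible) : 0 < S.kST := by
  have := h.kc_pos
  unfold kST
  positivity

lemma Admissible.wST_pos (h : S.Admissible) : 0 < S.wST := by
  have := h.kc_pos
  have := h.wc_pos
  have := h.nu_pos
  unfold wST
  positivity

end RISLink

/-! ### The Mellin transform of `log (1 + x)` -/

/-- `a log (1 + x) ≤ (1 + x) ^ a - 1 ≤ x ^ a`, the last step by subadditivity of the power. The case
`a = 1` controls the behaviour at `0`, small `a` that at infinity. -/
lemma log_one_add_le_rpow_div {a x : ℝ} (ha : 0 < a) (ha1 : a ≤ 1) (hx : 0 ≤ x) :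
    Real.log (1 + x) ≤ x ^ a / a := by
  rw [le_div_iff₀ ha, mul_comm, ← Real.log_rpow (by linarith)]
  have h := Real.rpow_add_le_add_rpow zero_le_one hx ha.le ha1
  rw [Real.one_rpow] at h
  linarith [Real.log_le_sub_one_of_pos (Real.rpow_pos_of_pos (show 0 < 1 + x by linarith) a)]

/-- Fubini condition for inserting `1 / (1 + x) = ∫ e^{-(1 + x)t} dt`. Integrating the norm over `x`
leaves `Γ(Re s) t ^ (-Re s) e^{-t}`, integrable since `Re s < 1`. -/
lemma integrable_prod_cpow_mul_exp {s : ℂ} (hs : 0 < s.re) (hs1 : s.re < 1) :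
    Integrable (Function.uncurry fun x t : ℝ =>
      (x : ℂ) ^ (s - 1) * Complex.exp (-((1 + x : ℝ) * t)))
      ((volume.restrict (Set.Ioi 0)).prod (volume.restrict (Set.Ioi 0))) := by
  have hnorm {x : ℝ} (hx : x ∈ Set.Ioi (0 : ℝ)) (t : ℝ) :
      ‖(x : ℂ) ^ (s - 1) * Complex.exp (-((1 + x : ℝ) * t))‖ =
        Real.exp (-t) * (x ^ (s.re - 1) * Real.exp (-(t * x))) := by
    rw [norm_mul, Complex.norm_cpow_eq_rpow_re_of_pos hx, Complex.norm_exp, mul_left_comm,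
      ← Real.exp_add]
    congr 2
    simp
    ring
  have hm : Measurable (Function.uncurry fun x t : ℝ =>
      (x : ℂ) ^ (s - 1) * Complex.exp (-((1 + x : ℝ) * t))) := by
    unfold Function.uncurry
    fun_prop
  rw [integrable_prod_iff' hm.aestronglyMeasurable]
  constructor
  · filter_upwards [ae_restrict_mem measurableSet_Ioi] with t (ht : 0 < t)
    have h : IntegrableOn (fun x : ℝ => x ^ (s.re - 1) * Real.exp (-t * x ^ (1 : ℝ)))
        (Set.Ioi 0) := integrableOn_rpow_mul_exp_neg_mul_rpow (by linarith) one_pos ht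
    refine (h.const_mul (Real.exp (-t))).mono
      (hm.comp measurable_prodMk_right).aestronglyMeasurable ?_
    filter_upwards [ae_restrict_mem measurableSet_Ioi] with x hx
    refine (hnorm hx t).le.trans (le_of_eq_of_le ?_ (Real.le_norm_self _))
    simp
  · have h := Real.GammaIntegral_convergent (s := 1 - s.re) (by linarith)
    refine (h.mul_const (Real.Gamma s.re)).congr ?_
    filter_upwards [ae_restrict_mem measurableSet_Ioi] with t (ht : 0 < t)
    simp only [Function.uncurry]
    rw [setIntegral_congr_fun measurableSet_Ioi fun x hx => hnorm hx t, integral_const_mul,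
      Real.integral_rpow_mul_exp_neg_mul_Ioi hs ht, one_div, Real.inv_rpow ht.le,
      ← Real.rpow_neg ht.le, mul_assoc]
    congr 3
    ring

lemma mellin_inv_one_add {s : ℂ} (hs : 0 < s.re) (hs1 : s.re < 1) :
    mellin (fun x : ℝ => ((1 + x : ℝ) : ℂ)⁻¹) s = Complex.Gamma s * Complex.Gamma (1 - s) := by
  have h := integral_integral_swap (integrable_prod_cpow_mul_exp hs hs1)
  have hl : ∀ x ∈ Set.Ioi (0 : ℝ),
      ∫ t in Set.Ioi (0 : ℝ), (x : ℂ) ^ (s - 1) * Complex.exp (-((1 + x : ℝ) * t)) =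
        (x : ℂ) ^ (s - 1) • ((1 + x : ℝ) : ℂ)⁻¹ := by
    intro x hx
    have h1 := Complex.integral_cpow_mul_exp_neg_mul_Ioi (a := 1) (r := 1 + x) (by simp)
      (by linarith [Set.mem_Ioi.mp hx])
    simp only [sub_self, Complex.cpow_zero, one_mul, Complex.cpow_one, Complex.Gamma_one,
      mul_one] at h1
    rw [integral_const_mul, h1, smul_eq_mul, one_div]
  have hr : ∀ t ∈ Set.Ioi (0 : ℝ),
      ∫ x in Set.Ioi (0 : ℝ), (x : ℂ) ^ (s - 1) * Complex.exp (-((1 + x : ℝ) * t)) =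
        (Real.exp (-t) : ℂ) * (t : ℂ) ^ (1 - s - 1) * Complex.Gamma s := by
    intro t (ht : 0 < t)
    have h1 (x : ℝ) : (x : ℂ) ^ (s - 1) * Complex.exp (-((1 + x : ℝ) * t)) =
        (Real.exp (-t) : ℂ) * ((x : ℂ) ^ (s - 1) * Complex.exp (-(t * x))) := by
      rw [mul_left_comm, Complex.ofReal_exp, ← Complex.exp_add]
      congr 2
      push_cast
      ring
    simp_rw [h1]
    rw [integral_const_mul, Complex.integral_cpow_mul_exp_neg_mul_Ioi hs ht, one_div,
      Complex.inv_cpow _ _ (by rw [Complex.arg_ofReal_of_nonneg ht.le]; exact Real.pi_pos.ne),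
      ← Complex.cpow_neg, mul_assoc]
    congr 3
    ring
  rw [setIntegral_congr_fun measurableSet_Ioi hl, setIntegral_congr_fun measurableSet_Ioi hr,
    integral_mul_const] at h
  rw [mellin, h, mul_comm (Complex.Gamma s),
    Complex.Gamma_eq_integral (s := 1 - s) (by simpa using hs1)]
  rfl

lemma mellinConvergent_inv_one_add {s : ℂ} (hs : 0 < s.re) (hs1 : s.re < 1) :
    MellinConvergent (fun x : ℝ => ((1 + x : ℝ) : ℂ)⁻¹) s := by
  refine mellinConvergent_of_isBigO_rpow (a := 1) (b := 0) ?_ ?_ hs1 ?_ hs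
  · refine ContinuousOn.locallyIntegrableOn (fun x (hx : 0 < x) => ?_) measurableSet_Ioi
    refine ContinuousAt.continuousWithinAt (ContinuousAt.inv₀ (by fun_prop) ?_)
    exact_mod_cast (by linarith : (1 + x) ≠ 0)
  · refine Asymptotics.IsBigO.of_bound 1 ?_
    filter_upwards [Filter.eventually_gt_atTop 0] with x hx
    rw [norm_inv, Complex.norm_real, Real.norm_of_nonneg (by linarith), Real.rpow_neg_one,
      norm_inv, Real.norm_of_nonneg hx.le, one_mul]
    gcongr
    linarith
  · refine Asymptotics.IsBigO.of_bound 1 ?_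
    filter_upwards [self_mem_nhdsWithin] with x (hx : 0 < x)
    rw [norm_inv, Complex.norm_real, Real.norm_of_nonneg (by linarith)]
    simp only [neg_zero, Real.rpow_zero, norm_one, mul_one]
    exact inv_le_one_of_one_le₀ (by linarith)

lemma mellinConvergent_log_one_add {s : ℂ} (hs : -1 < s.re) (hs0 : s.re < 0) :
    MellinConvergent (fun x : ℝ => (Real.log (1 + x) : ℂ)) s := by
  have hb {a x : ℝ} (ha : 0 < a) (ha1 : a ≤ 1) (hx : 0 < x) :
      ‖(Real.log (1 + x) : ℂ)‖ ≤ 1 / a * ‖x ^ a‖ := by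
    rw [Complex.norm_real, Real.norm_of_nonneg (Real.log_nonneg (by linarith)),
      Real.norm_of_nonneg (by positivity), one_div_mul_eq_div]
    exact log_one_add_le_rpow_div ha ha1 hx.le
  refine mellinConvergent_of_isBigO_rpow (a := s.re / 2) (b := -1) ?_ ?_ (by linarith) ?_ hs
  · refine ContinuousOn.locallyIntegrableOn (fun x (hx : 0 < x) => ?_) measurableSet_Ioi
    refine ContinuousAt.continuousWithinAt (Complex.continuous_ofReal.continuousAt.comp ?_)
    exact ContinuousAt.log (by fun_prop) (by linarith)
  · refine Asymptotics.IsBigO.of_bound (1 / (-(s.re / 2))) ?_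
    filter_upwards [Filter.eventually_gt_atTop 0] with x hx
    exact hb (by linarith) (by linarith) hx
  · refine Asymptotics.IsBigO.of_bound (1 / 1) ?_
    filter_upwards [self_mem_nhdsWithin] with x (hx : 0 < x)
    rw [neg_neg]
    exact hb one_pos le_rfl hx

lemma norm_cpow_div_mul_log_one_add_le {s : ℂ} {a x : ℝ} (ha : 0 < a) (ha1 : a ≤ 1) (hx : 0 < x) :
    ‖(x : ℂ) ^ s / s * (Real.log (1 + x) : ℂ)‖ ≤ x ^ (s.re + a) * (‖s‖⁻¹ / a) := by
  rw [norm_mul, norm_div, Complex.norm_cpow_eq_rpow_re_of_pos hx, Complex.norm_real,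
    Real.norm_of_nonneg (Real.log_nonneg (by linarith)), Real.rpow_add hx]
  calc _ ≤ x ^ s.re / ‖s‖ * (x ^ a / a) := by
        gcongr
        exact log_one_add_le_rpow_div ha ha1 hx.le
    _ = _ := by ring

/-- Integration by parts against `x ^ s / s` reduces to the transform of `1 / (1 + x)` at `s + 1`.
-/
lemma mellin_log_one_add {s : ℂ} (hs : -1 < s.re) (hs0 : s.re < 0) :
    mellin (fun x : ℝ => (Real.log (1 + x) : ℂ)) s =
      -(Complex.Gamma (-s) * Complex.Gamma (1 + s) / s) := by
  have hs' : s ≠ 0 := by rintro rfl; simp at hs0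
  have h1 := mellin_inv_one_add (s := s + 1) (by simp; linarith) (by simpa using hs0)
  have hc1 := mellinConvergent_inv_one_add (s := s + 1) (by simp; linarith) (by simpa using hs0)
  have hc2 := mellinConvergent_log_one_add hs hs0
  simp only [MellinConvergent, mellin, smul_eq_mul, add_sub_cancel_right] at h1 hc1 hc2 ⊢
  have hlim0 : Filter.Tendsto
      ((fun x : ℝ => (x : ℂ) ^ s / s) * fun x : ℝ => (Real.log (1 + x) : ℂ))
      (nhdsWithin 0 (Set.Ioi 0)) (nhds 0) := by
    have h : Filter.Tendsto (fun x : ℝ => x ^ (s.re + 1) * (‖s‖⁻¹ / 1))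
        (nhdsWithin 0 (Set.Ioi 0)) (nhds 0) := by
      have := (Real.continuousAt_rpow_const 0 (s.re + 1) (Or.inr (by linarith))).mul_const
        (‖s‖⁻¹ / 1)
      have := this.tendsto.mono_left (nhdsWithin_le_nhds (s := Set.Ioi 0))
      rwa [Real.zero_rpow (by linarith), zero_mul] at this
    refine squeeze_zero_norm' ?_ h
    filter_upwards [self_mem_nhdsWithin] with x hx
    exact norm_cpow_div_mul_log_one_add_le one_pos le_rfl hx
  have hlimtop : Filter.Tendsto
      ((fun x : ℝ => (x : ℂ) ^ s / s) * fun x : ℝ => (Real.log (1 + x) : ℂ))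
      Filter.atTop (nhds 0) := by
    -- With `a = -Re s / 2` the total exponent `Re s / 2` is still negative.
    have h : Filter.Tendsto (fun x : ℝ => x ^ (s.re + -(s.re / 2)) * (‖s‖⁻¹ / (-(s.re / 2))))
        Filter.atTop (nhds 0) := by
      have := (tendsto_rpow_neg_atTop (y := -(s.re / 2)) (by linarith)).mul_const
        (‖s‖⁻¹ / (-(s.re / 2)))
      rw [zero_mul] at this
      convert! this using 4
      ring
    refine squeeze_zero_norm' ?_ h
    filter_upwards [Filter.eventually_gt_atTop 0] with x hx
    exact norm_cpow_div_mul_log_one_add_le (by linarith) (by linarith) hx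
  have key := integral_Ioi_mul_deriv_eq_deriv_mul (a := 0)
    (u := fun x : ℝ => (x : ℂ) ^ s / s) (u' := fun x : ℝ => (x : ℂ) ^ (s - 1))
    (v := fun x : ℝ => (Real.log (1 + x) : ℂ)) (v' := fun x : ℝ => ((1 + x : ℝ) : ℂ)⁻¹)
    (fun x (hx : 0 < x) => ?_) (fun x (hx : 0 < x) => ?_) ?_ hc2 hlim0 hlimtop
  · have e (x : ℝ) : (x : ℂ) ^ s / s * ((1 + x : ℝ) : ℂ)⁻¹ =
        s⁻¹ * ((x : ℂ) ^ s * ((1 + x : ℝ) : ℂ)⁻¹) := by ring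
    simp_rw [e] at key
    rw [integral_const_mul, h1, sub_self, zero_sub] at key
    rw [← neg_eq_iff_eq_neg, ← key, show 1 - (s + 1) = -s by ring, add_comm s 1]
    ring
  · have := (hasDerivAt_ofReal_cpow_const hx.ne' hs').div_const s
    rwa [mul_div_cancel_left₀ _ hs'] at this
  · have h := ((hasDerivAt_id x).const_add 1).log (by simp; linarith)
    have := h.ofReal_comp
    simpa using this
  · refine (hc1.const_mul s⁻¹).congr (Filter.Eventually.of_forall fun x => ?_)
    simp only [Pi.mul_apply]
    ring

lemma Gamma_neg_mul_Gamma_one_add (s : ℂ) :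
    Complex.Gamma (-s) * Complex.Gamma (1 + s) = -(Real.pi / Complex.sin (Real.pi * s)) := by
  have h := Complex.Gamma_mul_Gamma_one_sub (-s)
  rwa [sub_neg_eq_add, mul_neg, Complex.sin_neg, div_neg] at h

lemma sq_norm_sin_add_mul_I (x y : ℝ) :
    ‖Complex.sin (x + y * Complex.I)‖ ^ 2 = Real.sin x ^ 2 + Real.sinh y ^ 2 := by
  have h : Complex.sin (x + y * Complex.I) =
      ((Real.sin x * Real.cosh y : ℝ) : ℂ) + ((Real.cos x * Real.sinh y : ℝ) : ℂ) * Complex.I := by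
    rw [Complex.sin_add_mul_I]
    push_cast
    rfl
  rw [h, Complex.sq_norm, Complex.normSq_add_mul_I, mul_pow, mul_pow, Real.cosh_sq, Real.cos_sq']
  ring

lemma sq_le_sq_sinh (y : ℝ) : y ^ 2 ≤ Real.sinh y ^ 2 := by
  rcases le_total 0 y with hy | hy
  · exact pow_le_pow_left₀ hy (Real.self_le_sinh_iff.mpr hy) 2
  · have h := Real.self_le_sinh_iff.mpr (neg_nonneg.mpr hy)
    rw [Real.sinh_neg] at h
    nlinarith

/-- The exponential decay of `1 / sin` is not needed: both `|s|²` and `|sin πs|²` are at least a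
constant times `1 + t²`, so the integrand is `O(1 / (1 + t²))`. -/
lemma integrable_pi_div_mul_sin {c : ℝ} (hc : -1 < c) (hc0 : c < 0) :
    Integrable fun t : ℝ => (Real.pi : ℂ) / ((c + t * Complex.I) *
      Complex.sin (Real.pi * (c + t * Complex.I))) := by
  have hpi := Real.pi_pos
  have hsin : Real.sin (Real.pi * c) < 0 :=
    Real.sin_neg_of_neg_of_neg_pi_lt (by nlinarith) (by nlinarith)
  set d := Real.sin (Real.pi * c) with hd
  set m := min (c ^ 2) (d ^ 2) with hm
  have hm0 : 0 < m := lt_min (sq_pos_of_ne_zero hc0.ne) (sq_pos_of_ne_zero hsin.ne)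
  -- Needed for the `t²` part of the two lower bounds, whose coefficient is only known to be at
  -- least `1`.
  have hm1 : m ≤ 1 := (min_le_left _ _).trans (by nlinarith)
  have hA (t : ℝ) : m * (1 + t ^ 2) ≤ ‖(c + t * Complex.I : ℂ)‖ ^ 2 := by
    rw [Complex.sq_norm, Complex.normSq_add_mul_I]
    nlinarith [min_le_left (c ^ 2) (d ^ 2), sq_nonneg t]
  have hB (t : ℝ) : m * (1 + t ^ 2) ≤ ‖Complex.sin (Real.pi * (c + t * Complex.I))‖ ^ 2 := by
    rw [show (Real.pi : ℂ) * (c + t * Complex.I) =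
      ((Real.pi * c : ℝ) : ℂ) + ((Real.pi * t : ℝ) : ℂ) * Complex.I by push_cast; ring,
      sq_norm_sin_add_mul_I, ← hd]
    have h1 := sq_le_sq_sinh (Real.pi * t)
    have h2 : t ^ 2 ≤ (Real.pi * t) ^ 2 := by
      rw [mul_pow]
      exact le_mul_of_one_le_left (sq_nonneg t) (by nlinarith [Real.pi_gt_three])
    nlinarith [min_le_right (c ^ 2) (d ^ 2), sq_nonneg t]
  refine (integrable_inv_one_add_sq.const_mul (Real.pi / m)).mono
    (Measurable.aestronglyMeasurable (by fun_prop)) (Filter.Eventually.of_forall fun t => ?_)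
  have ht : 0 < 1 + t ^ 2 := by positivity
  rw [norm_div, norm_mul, Complex.norm_real, Real.norm_of_nonneg hpi.le,
    Real.norm_of_nonneg (by positivity), ← div_eq_mul_inv, div_div]
  refine div_le_div_of_nonneg_left hpi.le (by positivity) ?_
  refine abs_le_of_sq_le_sq' ?_ (by positivity) |>.2
  rw [sq (m * (1 + t ^ 2)), mul_pow]
  exact mul_le_mul (hA t) (hB t) (by positivity) (by positivity)

lemma mellin_log_one_add_eq_pi_div {s : ℂ} (hs : -1 < s.re) (hs0 : s.re < 0) :
    mellin (fun x : ℝ => (Real.log (1 + x) : ℂ)) s =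
      Real.pi / (s * Complex.sin (Real.pi * s)) := by
  rw [mellin_log_one_add hs hs0, Gamma_neg_mul_Gamma_one_add, neg_div, neg_neg, div_div, mul_comm s]

/-- Mellin inversion for `log (1 + x)`. -/
lemma log_one_add_eq_integral {c x : ℝ} (hc : -1 < c) (hc0 : c < 0) (hx : 0 < x) :
    (Real.log (1 + x) : ℂ) = (1 / (2 * Real.pi) : ℝ) •
      ∫ t : ℝ, (x : ℂ) ^ (-(c + t * Complex.I)) * (Real.pi / ((c + t * Complex.I) *
        Complex.sin (Real.pi * (c + t * Complex.I)))) := by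
  have hL (t : ℝ) : mellin (fun x : ℝ => (Real.log (1 + x) : ℂ)) (c + t * Complex.I) =
      Real.pi / ((c + t * Complex.I) * Complex.sin (Real.pi * (c + t * Complex.I))) :=
    mellin_log_one_add_eq_pi_div (by simpa using hc) (by simpa using hc0)
  have h := mellinInv_mellin_eq c (fun x : ℝ => (Real.log (1 + x) : ℂ)) hx
    (mellinConvergent_log_one_add (by simpa using hc) (by simpa using hc0))
    ((integrable_pi_div_mul_sin hc hc0).congr (Filter.Eventually.of_forall fun t => (hL t).symm))
    (Complex.continuous_ofReal.continuousAt.comp (ContinuousAt.log (by fun_prop) (by linarith)))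
  simp only [mellinInv, hL, smul_eq_mul] at h
  exact h.symm

/-! ### Moments of the Gamma distribution -/

section GammaMoments

variable {k r : ℝ}

lemma ae_pos_gammaMeasure (k r : ℝ) : ∀ᵐ x ∂gammaMeasure k r, 0 < x := by
  have h : gammaMeasure k r (Set.Iic 0) = 0 := by
    rw [gammaMeasure, withDensity_apply _ measurableSet_Iic, setLIntegral_congr Iio_ae_eq_Iic.symm,
      lintegral_gammaPDF_of_nonpos le_rfl]
  rw [ae_iff]
  simpa [Set.Iic] using h

lemma measurable_gammaPDF (k r : ℝ) : Measurable (gammaPDF k r) :=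
  (measurable_gammaPDFReal k r).ennreal_ofReal

lemma ae_gammaPDF_smul_eq {E : Type*} [NormedAddCommGroup E] [NormedSpace ℝ E]
    (hk : 0 < k) (hr : 0 < r) (g : ℝ → E) :
    (fun x => (gammaPDF k r x).toReal • g x) =ᵐ[volume] (Set.Ioi 0).indicator
      fun x => (r ^ k / Real.Gamma k * x ^ (k - 1) * Real.exp (-(r * x))) • g x := by
  -- The density is defined by the formula at `0` too, where the indicator vanishes.
  filter_upwards [Measure.ae_ne volume 0] with x hx0
  rw [gammaPDF, ENNReal.toReal_ofReal (gammaPDFReal_nonneg hk hr x)]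
  rcases lt_or_gt_of_ne hx0 with hx | hx
  · rw [Set.indicator_of_notMem (by simpa using hx.le), gammaPDFReal, if_neg (not_le.mpr hx),
      zero_smul]
  · rw [Set.indicator_of_mem (by simpa using hx), gammaPDFReal, if_pos hx.le]

lemma integrable_gammaMeasure_iff {E : Type*} [NormedAddCommGroup E] [NormedSpace ℝ E]
    (hk : 0 < k) (hr : 0 < r) (g : ℝ → E) :
    Integrable g (gammaMeasure k r) ↔ IntegrableOn
      (fun x => (r ^ k / Real.Gamma k * x ^ (k - 1) * Real.exp (-(r * x))) • g x) (Set.Ioi 0) := by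
  rw [gammaMeasure, integrable_withDensity_iff_integrable_smul' (measurable_gammaPDF k r)
    (Filter.Eventually.of_forall fun x => ENNReal.ofReal_lt_top),
    integrable_congr (ae_gammaPDF_smul_eq hk hr g), integrable_indicator_iff measurableSet_Ioi]

lemma integral_gammaMeasure {E : Type*} [NormedAddCommGroup E] [NormedSpace ℝ E]
    (hk : 0 < k) (hr : 0 < r) (g : ℝ → E) :
    ∫ x, g x ∂gammaMeasure k r = ∫ x in Set.Ioi 0,
      (r ^ k / Real.Gamma k * x ^ (k - 1) * Real.exp (-(r * x))) • g x := by
  rw [gammaMeasure, integral_withDensity_eq_integral_toReal_smul (measurable_gammaPDF k r)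
    (Filter.Eventually.of_forall fun x => ENNReal.ofReal_lt_top),
    integral_congr_ae (ae_gammaPDF_smul_eq hk hr g), integral_indicator measurableSet_Ioi]

lemma integrable_rpow_gammaMeasure (hk : 0 < k) (hr : 0 < r) {p : ℝ} (hp : 0 < k + p) :
    Integrable (fun x : ℝ => x ^ p) (gammaMeasure k r) := by
  rw [integrable_gammaMeasure_iff hk hr]
  have h : IntegrableOn (fun x : ℝ => x ^ (k + p - 1) * Real.exp (-r * x ^ (1 : ℝ)))
      (Set.Ioi 0) := integrableOn_rpow_mul_exp_neg_mul_rpow (by linarith) one_pos hr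
  refine IntegrableOn.congr_fun (h.const_mul (r ^ k / Real.Gamma k)) (fun x (hx : 0 < x) => ?_)
    measurableSet_Ioi
  simp only [Real.rpow_one, smul_eq_mul, neg_mul]
  rw [show k + p - 1 = k - 1 + p by ring, Real.rpow_add hx]
  ring

lemma integral_cpow_neg_gammaMeasure (hk : 0 < k) (hr : 0 < r) {s : ℂ} (hs : s.re < k) :
    ∫ x : ℝ, (x : ℂ) ^ (-s) ∂gammaMeasure k r =
      (r : ℂ) ^ s * Complex.Gamma (k - s) / Complex.Gamma k := by
  have hr' : (r : ℂ) ≠ 0 := by exact_mod_cast hr.ne'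
  rw [integral_gammaMeasure hk hr]
  have e : ∀ x ∈ Set.Ioi (0 : ℝ),
      (r ^ k / Real.Gamma k * x ^ (k - 1) * Real.exp (-(r * x))) • (x : ℂ) ^ (-s) =
      ((r : ℂ) ^ (k : ℂ) / Complex.Gamma k) *
        ((x : ℂ) ^ ((k - s : ℂ) - 1) * Complex.exp (-(r * x))) := by
    intro x (hx : 0 < x)
    have hx' : (x : ℂ) ≠ 0 := by exact_mod_cast hx.ne'
    rw [Complex.real_smul, show (k - s : ℂ) - 1 = (k - 1 : ℝ) + -s by push_cast; ring,
      Complex.cpow_add _ _ hx', ← Complex.ofReal_cpow hx.le, ← Complex.ofReal_cpow hr.le,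
      Complex.Gamma_ofReal]
    push_cast
    ring
  rw [setIntegral_congr_fun measurableSet_Ioi e, integral_const_mul,
    Complex.integral_cpow_mul_exp_neg_mul_Ioi (by simpa using hs) hr, one_div,
    Complex.inv_cpow _ _ (by rw [Complex.arg_ofReal_of_nonneg hr.le]; exact Real.pi_pos.ne),
    Complex.cpow_sub _ _ hr']
  have h1 : (r : ℂ) ^ (k : ℂ) ≠ 0 := by simp [Complex.cpow_eq_zero_iff, hr']
  have h2 : (r : ℂ) ^ s ≠ 0 := by simp [Complex.cpow_eq_zero_iff, hr']
  field_simp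

lemma integrable_log_one_add_gammaMeasure (hk : 0 < k) (hr : 0 < r) :
    Integrable (fun x : ℝ => Real.log (1 + x)) (gammaMeasure k r) := by
  refine (integrable_rpow_gammaMeasure hk hr (p := 1) (by linarith)).mono
    (Measurable.aestronglyMeasurable (by fun_prop)) ?_
  filter_upwards [ae_pos_gammaMeasure k r] with x hx
  rw [Real.norm_of_nonneg (Real.log_nonneg (by linarith)), Real.norm_of_nonneg (by positivity)]
  simpa using log_one_add_le_rpow_div one_pos le_rfl hx.le

end GammaMoments

/-! ### The Mellin-Barnes integral -/

/-- The binding poles are `0`, from `Γ(-s)`, and `-1`, from `Γ(1 + s)`; those of `Γ(k - s)` lie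
further right. -/
lemma meijerGSeparates_iff {k : ℝ} (hk : 0 < k) (c : ℝ) :
    MeijerGSeparates 3 1 ![0, 1] ![0, 0, (k : ℂ)] c ↔ -1 < c ∧ c < 0 := by
  unfold MeijerGSeparates
  constructor
  · rintro ⟨h1, h2⟩
    have h1 := h1 0 (by simp) 0
    have h2 := h2 0 (by simp) 0
    simp at h1 h2
    exact ⟨h2, h1⟩
  · rintro ⟨h1, h2⟩
    refine ⟨fun j _ l => ?_, fun j hj l => ?_⟩
    · have := l.cast_nonneg (α := ℝ)
      fin_cases j <;> simp <;> linarith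
    · have := l.cast_nonneg (α := ℝ)
      have hj0 : j = 0 := by
        ext
        simpa using hj
      subst hj0
      simp
      linarith

/-- Since `Γ(1 - s) = -s Γ(-s)`, the denominator cancels one of the two factors `Γ(-s)`; reflection
handles `Γ(-s) Γ(1 + s)`. -/
lemma meijerGIntegrand_eq (k : ℝ) (z : ℂ) {s : ℂ} (hs0 : s.re < 0) :
    meijerGIntegrand 3 1 ![0, 1] ![0, 0, (k : ℂ)] z s =
      z ^ s * Complex.Gamma (k - s) * (Real.pi / (s * Complex.sin (Real.pi * s))) := by
  have hs' : s ≠ 0 := by rintro rfl; simp at hs0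
  have h1 : Complex.Gamma (1 - s) = -s * Complex.Gamma (-s) := by
    rw [← Complex.Gamma_add_one _ (neg_ne_zero.mpr hs'), neg_add_eq_sub]
  have h2 : Complex.Gamma (-s) ≠ 0 := Complex.Gamma_ne_zero_of_re_pos (by simpa using hs0)
  have h3 : (Real.pi : ℂ) / (s * Complex.sin (Real.pi * s)) =
      -(Complex.Gamma (-s) * Complex.Gamma (1 + s)) / s := by
    rw [Gamma_neg_mul_Gamma_one_add, neg_neg, div_div, mul_comm s]
  simp only [meijerGIntegrand, Fin.prod_univ_three, Fin.prod_univ_two]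
  simp [h1, h3]
  field_simp

section Line

variable {k r c : ℝ}

/-- On the line `|x ^ (-s)| = x ^ (-c)` does not depend on `t`, so the norm is a product of a finite
Gamma moment and an integrable function of `t`. -/
lemma integrable_prod_cpow_mul_pi_div (hk : 0 < k) (hr : 0 < r) (hc : -1 < c) (hc0 : c < 0) :
    Integrable (Function.uncurry fun x t : ℝ => (x : ℂ) ^ (-(c + t * Complex.I)) *
      (Real.pi / ((c + t * Complex.I) * Complex.sin (Real.pi * (c + t * Complex.I)))))
      ((gammaMeasure k r).prod volume) := by
  have := isProbabilityMeasure_gammaMeasure hk hr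
  have h := (integrable_rpow_gammaMeasure hk hr (p := -c) (by linarith)).ofReal (𝕜 := ℂ)
    |>.mul_prod (integrable_pi_div_mul_sin hc hc0)
  refine h.mono (Measurable.aestronglyMeasurable (by unfold Function.uncurry; fun_prop)) ?_
  filter_upwards [Measure.quasiMeasurePreserving_fst.ae (ae_pos_gammaMeasure k r)] with z hz
  simp only [Function.uncurry, norm_mul]
  rw [Complex.norm_cpow_eq_rpow_re_of_pos hz]
  simp [abs_of_pos (Real.rpow_pos_of_pos hz (-c))]

lemma integral_cpow_mul_pi_div (hk : 0 < k) (hr : 0 < r) (hc0 : c < 0) (t : ℝ) :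
    ∫ x : ℝ, (x : ℂ) ^ (-(c + t * Complex.I)) *
      (Real.pi / ((c + t * Complex.I) * Complex.sin (Real.pi * (c + t * Complex.I))))
      ∂gammaMeasure k r =
    meijerGIntegrand 3 1 ![0, 1] ![0, 0, (k : ℂ)] r (c + t * Complex.I) / Complex.Gamma k := by
  rw [integral_mul_const, integral_cpow_neg_gammaMeasure hk hr (by simp; linarith),
    meijerGIntegrand_eq _ _ (by simpa using hc0)]
  ring

/-- Absolute convergence comes from Fubini, as a partial integral of an integrable function, without
Stirling estimates. -/
lemma integrable_meijerGIntegrand (hk : 0 < k) (hr : 0 < r) (hc : -1 < c) (hc0 : c < 0) :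
    Integrable fun t : ℝ =>
      meijerGIntegrand 3 1 ![0, 1] ![0, 0, (k : ℂ)] r (c + t * Complex.I) := by
  have := isProbabilityMeasure_gammaMeasure hk hr
  have hG : Complex.Gamma k ≠ 0 := Complex.Gamma_ne_zero_of_re_pos (by simpa using hk)
  have h := (integrable_prod_cpow_mul_pi_div hk hr hc hc0).integral_prod_right.mul_const
    (Complex.Gamma k)
  simp only [Function.uncurry, integral_cpow_mul_pi_div hk hr hc0, div_mul_cancel₀ _ hG] at h
  exact h

/-- The right side is free of `c`, which is what makes the choice of line in `meijerG` immaterial.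
-/
lemma meijerGLine_eq_integral_log (hk : 0 < k) (hr : 0 < r) (hc : -1 < c) (hc0 : c < 0) :
    meijerGLine 3 1 ![0, 1] ![0, 0, (k : ℂ)] r c =
      Complex.Gamma k * ((∫ x, Real.log (1 + x) ∂gammaMeasure k r : ℝ) : ℂ) := by
  have := isProbabilityMeasure_gammaMeasure hk hr
  have hG : Complex.Gamma k ≠ 0 := Complex.Gamma_ne_zero_of_re_pos (by simpa using hk)
  have h1 : ((∫ x, Real.log (1 + x) ∂gammaMeasure k r : ℝ) : ℂ) =
      (1 / (2 * Real.pi) : ℝ) • ∫ t : ℝ,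
        meijerGIntegrand 3 1 ![0, 1] ![0, 0, (k : ℂ)] r (c + t * Complex.I) / Complex.Gamma k := by
    rw [← integral_complex_ofReal, integral_congr_ae ((ae_pos_gammaMeasure k r).mono
      fun x hx => log_one_add_eq_integral hc hc0 hx), integral_smul,
      integral_integral_swap (integrable_prod_cpow_mul_pi_div hk hr hc hc0)]
    simp_rw [integral_cpow_mul_pi_div hk hr hc0]
  rw [h1, integral_div, meijerGLine, integral_mul_const, Complex.real_smul]
  push_cast
  have := Complex.I_ne_zero
  have : (Real.pi : ℂ) ≠ 0 := by exact_mod_cast Real.pi_ne_zero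
  field_simp

lemma meijerG_eq_integral_log (hk : 0 < k) (hr : 0 < r) :
    meijerG 3 1 ![0, 1] ![0, 0, (k : ℂ)] r =
      Complex.Gamma k * ((∫ x, Real.log (1 + x) ∂gammaMeasure k r : ℝ) : ℂ) := by
  have h : ∃ c : ℝ, MeijerGSeparates 3 1 ![0, 1] ![0, 0, (k : ℂ)] c :=
    ⟨-1 / 2, (meijerGSeparates_iff hk _).mpr (by norm_num)⟩
  have hc := (meijerGSeparates_iff hk _).mp h.choose_spec
  rw [meijerG, dif_pos h, meijerGLine_eq_integral_log hk hr hc.1 hc.2]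

lemma meijerGWellDefined (hk : 0 < k) (hr : 0 < r) :
    MeijerGWellDefined 3 1 ![0, 1] ![0, 0, (k : ℂ)] r := by
  refine ⟨⟨-1 / 2, (meijerGSeparates_iff hk _).mpr (by norm_num)⟩, fun c hc => ?_⟩
  obtain ⟨hc, hc0⟩ := (meijerGSeparates_iff hk c).mp hc
  exact ⟨integrable_meijerGIntegrand hk hr hc hc0, by
    rw [meijerG_eq_integral_log hk hr, meijerGLine_eq_integral_log hk hr hc hc0]⟩

end Line

/-! ### The ergodic rate -/

lemma ergodicRate_eq_of_hasLaw_gammaMeasure {Ω : Type*} [MeasurableSpace Ω] {P : Measure Ω}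
    {γ : Ω → ℝ} {k r : ℝ} (hk : 0 < k) (hr : 0 < r) (h : HasLaw γ (gammaMeasure k r) P) :
    Integrable (fun x => Real.logb 2 (1 + γ x)) P ∧
      (ergodicRate P γ : ℂ) = 1 / ((Real.Gamma k * Real.log 2 : ℝ) : ℂ) *
        meijerG 3 1 ![0, 1] ![0, 0, (k : ℂ)] r := by
  have hi : Integrable (fun x : ℝ => Real.logb 2 (1 + x)) (gammaMeasure k r) :=
    (integrable_log_one_add_gammaMeasure hk hr).div_const _
  constructor
  · rw [← h.map_eq] at hi
    exact hi.comp_aemeasurable h.aemeasurable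
  · have h1 : ergodicRate P γ = (∫ x, Real.log (1 + x) ∂gammaMeasure k r) / Real.log 2 := by
      rw [ergodicRate, ← integral_div]
      exact h.integral_comp hi.aestronglyMeasurable
    have hG : Complex.Gamma k ≠ 0 := Complex.Gamma_ne_zero_of_re_pos (by simpa using hk)
    rw [h1, meijerG_eq_integral_log hk hr, Complex.ofReal_mul, ← Complex.Gamma_ofReal,
      Complex.ofReal_div]
    field_simp

theorem lemma2 {Ω : Type*} [MeasurableSpace Ω] (P : Measure Ω) [IsProbabilityMeasure P]
    (γ : Ω → ℝ) :
    -- any shape `k` and scale `w`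
    (∀ k w : ℝ, 0 < k → 0 < w → HasLaw γ (gammaMeasure k (1 / w)) P →
      MeijerGWellDefined 3 1 ![0, 1] ![0, 0, (k : ℂ)] ((1 / w : ℝ) : ℂ) ∧
      Integrable (fun x => Real.logb 2 (1 + γ x)) P ∧
      (ergodicRate P γ : ℂ) = 1 / ((Real.Gamma k * Real.log 2 : ℝ) : ℂ) *
        meijerG 3 1 ![0, 1] ![0, 0, (k : ℂ)] ((1 / w : ℝ) : ℂ)) ∧
    -- phase shifts `θ` that do not depend on the small-scale fading: arbitrary ones, hence in
    -- particular the long-term optimal ones, which are computed from the line-of-sight channels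
    (∀ S : RISLink, S.Admissible → ∀ θ : Fin S.M → ℝ,
      0 < S.kLT θ ∧ 0 < S.wLT θ ∧
      (HasLaw γ (gammaMeasure (S.kLT θ) (1 / S.wLT θ)) P →
        (ergodicRate P γ : ℂ) = 1 / ((Real.Gamma (S.kLT θ) * Real.log 2 : ℝ) : ℂ) *
          meijerG 3 1 ![0, 1] ![0, 0, (S.kLT θ : ℂ)] ((1 / S.wLT θ : ℝ) : ℂ))) ∧
    -- the short-term optimal phase shifts
    (∀ S : RISLink, S.Admissible →
      0 < S.kST ∧ 0 < S.wST ∧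
      (HasLaw γ (gammaMeasure S.kST (1 / S.wST)) P →
        (ergodicRate P γ : ℂ) = 1 / ((Real.Gamma S.kST * Real.log 2 : ℝ) : ℂ) *
          meijerG 3 1 ![0, 1] ![0, 0, (S.kST : ℂ)] ((1 / S.wST : ℝ) : ℂ))) := by
  -- `gammaMeasure` is parametrised by the rate, so scale `w` enters as `r = 1 / w`, which is also
  -- the argument of the G-function.
  refine ⟨fun k w hk hw h => ⟨meijerGWellDefined hk (one_div_pos.mpr hw),
      ergodicRate_eq_of_hasLaw_gammaMeasure hk (one_div_pos.mpr hw) h⟩, fun S hS θ => ?_,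
    fun S hS => ?_⟩
  · exact ⟨hS.kLT_pos θ, hS.wLT_pos θ, fun h =>
      (ergodicRate_eq_of_hasLaw_gammaMeasure (hS.kLT_pos θ) (one_div_pos.mpr (hS.wLT_pos θ)) h).2⟩
  · exact ⟨hS.kST_pos, hS.wST_pos, fun h =>
      (ergodicRate_eq_of_hasLaw_gammaMeasure hS.kST_pos (one_div_pos.mpr hS.wST_pos) h).2⟩
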